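/- Let $\Delta$ be an irreducible reduced crystallographic root system in a real vector space $V$ with exactly two root lengths (for instance, the root system of a complex simple Lie algebra $\mathfrak g$ of type $B_p$, $C_p$, $F_4$ or $G_2$ with respect to a Cartan subalgebra $\mathfrak t$), where lengths are taken with respect to a Weyl-group-invariant inner product $(\ ,\ )$ on $V$. Let $\Delta^+$ be the set of positive roots with respect to a basis of simple roots $\Pi=\{\alpha_1,\dots,\alpha_p\}$, and let $\theta$ be the highest root. An Abelian ideal is a subset $I\subset\Delta^+$ such that (a) $\mu+\nu\notin\Delta$ for all $\mu,\nu\in I$, and (b) $\gamma+\nu\in I$ whenever $\gamma\in I$, $\nu\in\Delta^+$ and $\gamma+\nu\in\Delta$. It is nontrivial if $I\neq\varnothing$, and long if all its elements are long roots. Let $\widehat V=V\oplus\mathbb R\delta\oplus\mathbb R\lambda$, with the inner product extended by $(\delta,V)=(\lambda,V)=(\delta,\delta)=(\lambda,\lambda)=0$ and $(\delta,\lambda)=1$. Let $\widehat\Delta^+=\Delta^+\cup\{\alpha+k\delta\mid \alpha\in\Delta,\ k\ge 1\}$, let $\alpha_0=\delta-\theta$, and let $\widehat W$ be the affine Weyl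 group, generated by the orthogonal reflections $s_0,\dots,s_p$ of $\widehat V$ in $\alpha_0,\dots,\alpha_p$. For $w\in\widehat W$ put $\widehat N(w)=\{x\in\widehat\Delta^+\mid w(x)\in-\widehat\Delta^+\}$. Proposition. Let $I$ be a nontrivial Abelian ideal. There is exactly one $w\in\widehat W$ with $\widehat N(w)=\{\delta-\gamma\mid\gamma\in I\}$ (the minuscule element of $I$), and $\tau(I):=w(\alpha_0)+\delta$ (the rootlet of $I$) is a long positive root. Moreover, the following are equivalent: 1. $I$ is long; 2. $\theta-\tau(I)$ is a (possibly empty) sum of long simple roots, repetitions allowed; 3. for every short simple root $\alpha_i$, the coefficients of $\alpha_i$ in $\theta$ and in $\tau(I)$ are equal. -/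

import Mathlib

open Set

noncomputable section

namespace LongAbelianIdeal

/-! ### The highest root -/

section HighestRoot

variable {ι V N : Type*} [AddCommGroup V] [Module ℝ V] [AddCommGroup N] [Module ℝ N]
  {P : RootPairing ι ℝ V N}

/-- The submonoid `∑ ℕ αᵢ` of nonnegative integral combinations of the simple roots. -/
def posCone (b : P.Base) : AddSubmonoid V :=
  AddSubmonoid.closure (P.root '' b.support)

/-- `θ` is a highest root: for every root `β`, the difference `θ - β` is a sum of simple roots. -/
def IsHighest (b : P.Base) (t : ι) : Prop :=
  ∀ i, P.root t - P.root i ∈ posCone b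

/-- `γ` is a maximal root: no `γ + αᵢ`, with `αᵢ` simple, is a root. -/
def IsMaxRoot (b : P.Base) (i : ι) : Prop :=
  ∀ j ∈ b.support, P.root i + P.root j ∉ range P.root

lemma exists_sum_of_isPos (b : P.Base) {i : ι} (hi : b.IsPos i) :
    ∃ f : ι → ℕ, P.root i = ∑ j ∈ b.support, f j • P.root j := by
  obtain ⟨f, -, h | h⟩ := b.exists_root_eq_sum_nat_or_neg i
  · exact ⟨f, h⟩
  · exfalso
    have h' : P.root i = ∑ j ∈ b.support, (fun j => -(f j : ℤ)) j • P.root j := by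
      rw [h]; simp
    have := RootPairing.Base.height_eq_sum h'
    rw [RootPairing.Base.isPos_iff, this] at hi
    have : ∑ j ∈ b.support, (-(f j : ℤ)) ≤ 0 := Finset.sum_nonpos fun j _ => by simp
    omega

lemma mem_posCone_of_isPos (b : P.Base) {i : ι} (hi : b.IsPos i) :
    P.root i ∈ posCone b := by
  obtain ⟨f, hf⟩ := exists_sum_of_isPos b hi
  rw [hf]
  exact sum_mem fun j hj => nsmul_mem (show P.root j ∈ posCone b from AddSubmonoid.subset_closure ⟨j, hj, rfl⟩) _

lemma pairingIn_sum [P.IsCrystallographic] (b : P.Base) {i : ι} {f : ι → ℕ}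
    (hf : P.root i = ∑ j ∈ b.support, f j • P.root j) (k : ι) :
    P.pairingIn ℤ i k = ∑ j ∈ b.support, f j * P.pairingIn ℤ j k := by
  have : (algebraMap ℤ ℝ) (P.pairingIn ℤ i k) =
      (algebraMap ℤ ℝ) (∑ j ∈ b.support, f j * P.pairingIn ℤ j k) := by
    rw [P.algebraMap_pairingIn, map_sum, ← P.root_coroot'_eq_pairing, hf, map_sum]
    refine Finset.sum_congr rfl fun j _ => ?_
    rw [map_nsmul, P.root_coroot'_eq_pairing, map_mul, P.algebraMap_pairingIn]
    simp
  exact_mod_cast this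

lemma pairingIn_nonneg [Finite ι] [P.IsCrystallographic] (b : P.Base) {i j : ι}
    (hm : IsMaxRoot b i) (hi : b.IsPos i) (hj : j ∈ b.support) : 0 ≤ P.pairingIn ℤ i j := by
  by_contra! h
  refine hm j hj (P.root_add_root_mem_of_pairingIn_neg h fun h' => ?_)
  let := P.indexNeg
  have : i = -j := by simpa using h'
  subst this
  exact (RootPairing.Base.IsPos.neg_iff_not b j).1 hi (RootPairing.Base.isPos_of_mem_support hj)

lemma coeff_ne_zero [Finite ι] [P.IsCrystallographic] [P.IsReduced] [P.IsIrreducible]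
    (b : P.Base) {i : ι} {f : ι → ℕ} (hm : IsMaxRoot b i) (hi : b.IsPos i)
    (hf : P.root i = ∑ j ∈ b.support, f j • P.root j) {j : ι} (hj : j ∈ b.support) :
    f j ≠ 0 := by
  obtain ⟨k, hk, hfk⟩ : ∃ k ∈ b.support, f k ≠ 0 := by
    by_contra! h
    exact P.ne_zero i (by rw [hf]; exact Finset.sum_eq_zero fun k hk => by simp [h k hk])
  refine b.induction_on_cartanMatrix (fun x => f x ≠ 0) (i := ⟨k, hk⟩) (j := ⟨j, hj⟩) hfk ?_
  rintro ⟨k, hk⟩ ⟨l, hl⟩ hfk hkl hfl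
  simp only at hfk hfl
  have h0 := pairingIn_nonneg b hm hi hl
  rw [pairingIn_sum b hf] at h0
  have hle : ∀ m ∈ b.support, (f m : ℤ) * P.pairingIn ℤ m l ≤ 0 := by
    intro m hm'
    rcases eq_or_ne m l with rfl | hne
    · simp [hfl]
    · exact mul_nonpos_of_nonneg_of_nonpos (by positivity)
        (b.pairingIn_le_zero_of_ne hne hm' hl)
  have heq := (Finset.sum_eq_zero_iff_of_nonpos hle).1
    (le_antisymm (Finset.sum_nonpos hle) h0) k hk
  have hz : P.pairingIn ℤ k l = 0 := by
    rcases mul_eq_zero.1 heq with h | h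
    · exact absurd (by exact_mod_cast h) hfk
    · exact h
  refine hkl ?_
  change P.pairingIn ℤ l k = 0
  rwa [P.pairingIn_eq_zero_iff]

lemma isMaxRoot_unique [Finite ι] [P.IsCrystallographic] [P.IsReduced] [P.IsIrreducible]
    (b : P.Base) {i k : ι} (hmi : IsMaxRoot b i) (hi : b.IsPos i)
    (hmk : IsMaxRoot b k) (hk : b.IsPos k)
    (hup : ∀ m : ι, P.root m - P.root i ∈ posCone b → m = i)
    (hup' : ∀ m : ι, P.root m - P.root k ∈ posCone b → m = k) : i = k := by
  by_contra hne
  obtain ⟨f, hf⟩ := exists_sum_of_isPos b hi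
  have hpos : 0 < P.pairingIn ℤ i k := by
    rw [pairingIn_sum b hf]
    obtain ⟨j, hj, hjk⟩ := hk.exists_mem_support_pos_pairingIn
    refine Finset.sum_pos' (fun m hm => ?_) ⟨j, hj, ?_⟩
    · refine mul_nonneg (by positivity) ?_
      by_contra! hneg
      have h1 := pairingIn_nonneg b hmk hk hm
      rcases h1.lt_or_eq with h2 | h2
      · rw [P.zero_lt_pairingIn_iff'] at h2
        omega
      · have := (P.pairingIn_eq_zero_iff (S := ℤ)).1 h2.symm
        omega
    · have := coeff_ne_zero b hmi hi hf hj
      positivity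
  obtain ⟨l, hl⟩ := P.root_sub_root_mem_of_pairingIn_pos hpos hne
  let := P.indexNeg
  rcases RootPairing.Base.IsPos.or_neg b l with h | h
  · refine hne (hup' i ?_)
    rw [← hl]
    exact mem_posCone_of_isPos b h
  · refine hne (hup k ?_).symm
    have h2 := mem_posCone_of_isPos b h
    rw [← neg_sub, ← hl]
    simpa using h2

lemma height_nonneg_of_mem (b : P.Base) {i k : ι}
    (h : P.root k - P.root i ∈ posCone b) (hne : k ≠ i) : b.height i < b.height k := by
  obtain ⟨g, -, hg⟩ : ∃ g : ι → ℤ, (∀ j, 0 ≤ g j) ∧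
      (P.root k - P.root i = ∑ j ∈ b.support, g j • P.root j) ∧
      (0 < ∑ j ∈ b.support, g j ∨ P.root k - P.root i = 0) := by
    refine AddSubmonoid.closure_induction (motive := fun x _ => ∃ g : ι → ℤ, (∀ j, 0 ≤ g j) ∧
      (x = ∑ j ∈ b.support, g j • P.root j) ∧ (0 < ∑ j ∈ b.support, g j ∨ x = 0)) ?_ ?_ ?_ h
    · rintro _ ⟨j, hj, rfl⟩
      classical
      refine ⟨Pi.single j 1, fun m => ?_, ?_, ?_⟩
      · by_cases hm : m = j
        · subst hm; simp
        · simp [hm]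
      · rw [Finset.sum_eq_single j]
        · simp
        · intro m _ hm; simp [hm]
        · intro h; exact absurd hj h
      · left
        rw [Finset.sum_eq_single j]
        · simp
        · intro m _ hm; simp [hm]
        · intro h; exact absurd hj h
    · exact ⟨0, by simp, by simp, by simp⟩
    · rintro x y - - ⟨g, hg0, hg1, hg2⟩ ⟨h, hh0, hh1, hh2⟩
      refine ⟨g + h, fun j => add_nonneg (hg0 j) (hh0 j), ?_, ?_⟩
      · rw [hg1, hh1, ← Finset.sum_add_distrib]
        exact Finset.sum_congr rfl fun j _ => by simp [add_smul]
      · have e1 : 0 ≤ ∑ j ∈ b.support, g j := Finset.sum_nonneg fun j _ => hg0 j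
        have e2 : 0 ≤ ∑ j ∈ b.support, h j := Finset.sum_nonneg fun j _ => hh0 j
        simp only [Pi.add_apply, Finset.sum_add_distrib]
        rcases hg2 with hg2 | hg2
        · left; omega
        · rcases hh2 with hh2 | hh2
          · left; omega
          · right; simp [hg2, hh2]
  obtain ⟨hg1, hg2⟩ := hg
  have hpos : 0 < ∑ j ∈ b.support, g j := by
    rcases hg2 with h | h
    · exact h
    · exact absurd (P.root.injective (sub_eq_zero.1 h)) hne
  obtain ⟨f, -, -, hf⟩ := b.exists_root_eq_sum_int i
  have hk : P.root k = ∑ j ∈ b.support, (g + f) j • P.root j := by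
    rw [← sub_add_cancel (P.root k) (P.root i), hg1, hf, ← Finset.sum_add_distrib]
    exact Finset.sum_congr rfl fun j _ => by simp [add_smul]
  rw [RootPairing.Base.height_eq_sum hk, RootPairing.Base.height_eq_sum hf]
  simp only [Pi.add_apply, Finset.sum_add_distrib]
  omega

lemma exists_max_above [Finite ι] (b : P.Base) (i : ι) :
    ∃ k, P.root k - P.root i ∈ posCone b ∧
      ∀ m : ι, P.root m - P.root k ∈ posCone b → m = k := by
  obtain ⟨k, hk, hmax⟩ := Set.exists_max_image {k | P.root k - P.root i ∈ posCone b}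
    b.height (Set.toFinite _) ⟨i, by simp [zero_mem]⟩
  refine ⟨k, hk, fun m hm => ?_⟩
  by_contra hne
  have h1 := height_nonneg_of_mem b hm hne
  have h2 := hmax m (by
    have := add_mem hm hk
    simpa using this)
  omega

lemma isMaxRoot_of_top (b : P.Base) {k : ι}
    (h : ∀ m : ι, P.root m - P.root k ∈ posCone b → m = k) : IsMaxRoot b k := by
  rintro j hj ⟨m, hm⟩
  have := h m (by
    rw [hm, add_sub_cancel_left]
    exact AddSubmonoid.subset_closure ⟨j, hj, rfl⟩)
  subst this
  exact P.ne_zero j (by simpa using hm)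

lemma isPos_of_top (b : P.Base) {k : ι}
    (h : ∀ m : ι, P.root m - P.root k ∈ posCone b → m = k) : b.IsPos k := by
  let := P.indexNeg
  rcases RootPairing.Base.IsPos.or_neg b k with hk | hk
  · exact hk
  · have h2 := mem_posCone_of_isPos b hk
    have := h (-k) (by
      have := add_mem h2 h2
      simpa [sub_eq_add_neg] using this)
    rwa [this] at hk

/-- An irreducible reduced crystallographic root system has exactly one highest root. -/
lemma existsUnique_isHighest [Finite ι] [P.IsCrystallographic] [P.IsReduced] [P.IsIrreducible]
    (b : P.Base) [Nonempty ι] : ∃! t, IsHighest b t := by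
  obtain ⟨t, -, ht⟩ := exists_max_above b (Classical.arbitrary ι)
  refine ⟨t, fun i => ?_, fun s hs => ht s (hs t)⟩
  obtain ⟨k, hk, hk'⟩ := exists_max_above b i
  have := isMaxRoot_unique b (isMaxRoot_of_top b ht) (isPos_of_top b ht)
    (isMaxRoot_of_top b hk') (isPos_of_top b hk') ht hk'
  rwa [this]

lemma nonempty_index (P : RootPairing ι ℝ V N) [P.IsRootSystem] [P.IsIrreducible] :
    Nonempty ι := by
  by_contra h
  rw [not_nonempty_iff] at h
  have h1 := RootPairing.IsRootSystem.span_root_eq_top (P := P)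
  have := RootPairing.IsIrreducible.nontrivial P
  have h2 : (⊥ : Submodule ℝ V) = ⊤ := by
    rw [← h1]
    simp [Set.range_eq_empty]
  exact bot_ne_top h2

/-- The highest root `θ` (as an index). -/
def highestRoot [Finite ι] [P.IsRootSystem] [P.IsCrystallographic] [P.IsReduced] [P.IsIrreducible]
    (b : P.Base) : ι :=
  haveI := nonempty_index P
  (existsUnique_isHighest b).choose

lemma highestRoot_isHighest [Finite ι] [P.IsRootSystem] [P.IsCrystallographic] [P.IsReduced]
    [P.IsIrreducible] (b : P.Base) : IsHighest b (highestRoot b) :=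
  haveI := nonempty_index P
  (existsUnique_isHighest b).choose_spec.1

end HighestRoot

/-! ### Long and short roots -/

section Lengths

variable {ι V N : Type*} [AddCommGroup V] [Module ℝ V] [AddCommGroup N] [Module ℝ N]
  {P : RootPairing ι ℝ V N}

/-- There are exactly two root lengths. -/
def HasTwoRootLengths (B : P.InvariantForm) : Prop :=
  (range fun i => B.form (P.root i) (P.root i)).ncard = 2

/-- A root is long if it has the maximal length. -/
def IsLong (B : P.InvariantForm) (i : ι) : Prop :=
  ∀ j, B.form (P.root j) (P.root j) ≤ B.form (P.root i) (P.root i)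

/-- A root is short if it has the minimal length. -/
def IsShort (B : P.InvariantForm) (i : ι) : Prop :=
  ∀ j, B.form (P.root i) (P.root i) ≤ B.form (P.root j) (P.root j)

/-- The set of sums (with repetitions, the empty sum included) of long simple roots. -/
def longSimpleSums (b : P.Base) (B : P.InvariantForm) : AddSubmonoid V :=
  AddSubmonoid.closure (P.root '' {i | i ∈ b.support ∧ IsLong B i})

end Lengths

/-! ### Abelian ideals -/

section AbelianIdeals

variable {ι V N : Type*} [AddCommGroup V] [Module ℝ V] [AddCommGroup N] [Module ℝ N]
  {P : RootPairing ι ℝ V N}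

/-- (Combinatorial) Abelian ideals: sets of positive roots such that no sum of two members is a
root, and that contain every root of the form `γ + ν` with `γ` in the set and `ν` positive. -/
structure IsAbelianIdeal (b : P.Base) (I : Set ι) : Prop where
  isPos : ∀ i ∈ I, b.IsPos i
  add_notMem : ∀ i ∈ I, ∀ j ∈ I, P.root i + P.root j ∉ range P.root
  mem_of_add : ∀ i ∈ I, ∀ j, b.IsPos j → ∀ k, P.root k = P.root i + P.root j → k ∈ I

/-- An Abelian ideal is long if it consists of long roots. -/
def IsLongIdeal (B : P.InvariantForm) (I : Set ι) : Prop :=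
  ∀ i ∈ I, IsLong B i

end AbelianIdeals

/-! ### The affine root system and the affine Weyl group -/

section Affine

variable {ι V N : Type*} [AddCommGroup V] [Module ℝ V] [AddCommGroup N] [Module ℝ N]
  {P : RootPairing ι ℝ V N}

/-- The space `V ⊕ ℝδ ⊕ ℝλ`; the triple `(v, k, l)` stands for `v + kδ + lλ`. -/
abbrev AffSpace (V : Type*) := V × ℝ × ℝ

/-- The vector `δ`. -/
def delta (V : Type*) [AddCommGroup V] : AffSpace V := (0, 1, 0)

/-- The invariant form extended to `V ⊕ ℝδ ⊕ ℝλ` by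
`(δ, V) = (λ, V) = (δ, δ) = (λ, λ) = 0` and `(δ, λ) = 1`. -/
def affForm (B : P.InvariantForm) : LinearMap.BilinForm ℝ (AffSpace V) :=
  LinearMap.mk₂ ℝ
    (fun x y => B.form x.1 y.1 + x.2.1 * y.2.2 + x.2.2 * y.2.1)
    (fun x x' y => by simp; ring) (fun c x y => by simp; ring)
    (fun x y y' => by simp; ring) (fun c x y => by simp; ring)

lemma affForm_apply (B : P.InvariantForm) (x y : AffSpace V) :
    affForm B x y = B.form x.1 y.1 + x.2.1 * y.2.2 + x.2.2 * y.2.1 := rfl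

/-- The affine real root `α + kδ`, for a root `α` and an integer `k`. -/
def affRoot (P : RootPairing ι ℝ V N) (i : ι) (k : ℤ) : AffSpace V := (P.root i, (k : ℝ), 0)

lemma affForm_affRoot_self (B : P.InvariantForm) (i : ι) (k : ℤ) :
    affForm B (affRoot P i k) (affRoot P i k) = B.form (P.root i) (P.root i) := by
  simp [affForm_apply, affRoot]

/-- The orthogonal reflection `x ↦ x - (2 (x, a) / (a, a)) a` in the affine real root
`a = α + kδ`. -/
def affReflection (B : P.InvariantForm) (i : ι) (k : ℤ) : AffSpace V ≃ₗ[ℝ] AffSpace V :=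
  Module.reflection (x := affRoot P i k)
    (f := (2 / affForm B (affRoot P i k) (affRoot P i k)) • LinearMap.flip (affForm B) (affRoot P i k))
    (by
      have h : affForm B (affRoot P i k) (affRoot P i k) ≠ 0 := by
        rw [affForm_affRoot_self]; exact B.ne_zero i
      rw [LinearMap.smul_apply, LinearMap.flip_apply, smul_eq_mul, div_mul_cancel₀ _ h])

lemma affReflection_apply (B : P.InvariantForm) (i : ι) (k : ℤ) (x : AffSpace V) :
    affReflection B i k x =
      x - (2 * affForm B x (affRoot P i k) / affForm B (affRoot P i k) (affRoot P i k)) •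
        affRoot P i k := by
  rw [affReflection, Module.reflection_apply, LinearMap.smul_apply, LinearMap.flip_apply,
    smul_eq_mul, div_mul_eq_mul_div]

/-- The positive affine real roots: `α` with `α` positive, and `α + kδ` with `k ≥ 1` and
`α` any root. -/
def affPosRoots (b : P.Base) : Set (AffSpace V) :=
  {x | ∃ (i : ι) (k : ℤ), x = affRoot P i k ∧ (1 ≤ k ∨ k = 0 ∧ b.IsPos i)}

/-- The simple affine root `α₀ = δ - θ`, written as `(-θ) + 1·δ`. -/
def alphaZero [Finite ι] [P.IsRootSystem] [P.IsCrystallographic] [P.IsReduced]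
    [P.IsIrreducible] (b : P.Base) : AffSpace V :=
  affRoot P (P.reflectionPerm (highestRoot b) (highestRoot b)) 1

lemma alphaZero_eq [Finite ι] [P.IsRootSystem] [P.IsCrystallographic] [P.IsReduced]
    [P.IsIrreducible] (b : P.Base) :
    alphaZero b = delta V - affRoot P (highestRoot b) 0 := by
  simp [alphaZero, delta, affRoot]

/-- The simple reflection `s₀` in `α₀`. -/
def reflectionZero [Finite ι] [P.IsRootSystem] [P.IsCrystallographic] [P.IsReduced]
    [P.IsIrreducible] (b : P.Base) (B : P.InvariantForm) : AffSpace V ≃ₗ[ℝ] AffSpace V :=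
  affReflection B (P.reflectionPerm (highestRoot b) (highestRoot b)) 1

/-- The affine Weyl group, acting linearly on `V ⊕ ℝδ ⊕ ℝλ`: the group generated by the simple
reflections `s₀, s₁, …, s_p`. -/
def affWeylGroup [Finite ι] [P.IsRootSystem] [P.IsCrystallographic] [P.IsReduced]
    [P.IsIrreducible] (b : P.Base) (B : P.InvariantForm) : Subgroup (AffSpace V ≃ₗ[ℝ] AffSpace V) :=
  Subgroup.closure (insert (reflectionZero b B) ((fun i => affReflection B i 0) '' b.support))

/-- The inversion set of `w`: the positive affine roots that `w` makes negative. -/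
def affInversions (b : P.Base) (w : AffSpace V ≃ₗ[ℝ] AffSpace V) : Set (AffSpace V) :=
  {x | x ∈ affPosRoots b ∧ -(w x) ∈ affPosRoots b}

/-- `w` is a minuscule element of the affine Weyl group with set of roots `I`, that is, its
inversion set equals `{δ - γ | γ ∈ I}`. -/
def IsMinusculeOf [Finite ι] [P.IsRootSystem] [P.IsCrystallographic] [P.IsReduced]
    [P.IsIrreducible] (b : P.Base) (B : P.InvariantForm)
    (w : AffSpace V ≃ₗ[ℝ] AffSpace V) (I : Set ι) : Prop :=
  w ∈ affWeylGroup b B ∧ affInversions b w = {x | ∃ i ∈ I, x = delta V - affRoot P i 0}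

end Affine

end LongAbelianIdeal

end

open LongAbelianIdeal

/-! The minuscule element is built one root at a time, and its rootlet is followed along the way.
Let `γ` be a root of least height in `I`; then `I \ {γ}` is again an Abelian ideal. If `w` is
minuscule for it, `w(δ - γ)` is a simple affine root `α`: otherwise it is a sum of two positive
affine roots, and pulling the summands back by `w` contradicts the ideal property or commutativity
(`IsMinusculeOf.exists_isAffSimple`). Hence `s_α w` is minuscule for `I`.

Since `w` is an isometry fixing `δ`, the old rootlet `τ` satisfies `⟨τ, α^∨⟩ = ⟨θ, γ^∨⟩ ≥ 0`. If `α
= α₀`, then `⟨τ, α^∨⟩ = -⟨τ, θ^∨⟩ ≤ 0`, so both numbers vanish and the rootlet does not change. If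
`α = αᵢ`, the new rootlet is `τ - ⟨θ, γ^∨⟩ αᵢ`, and `αᵢ` is as long as `γ`. So the rootlet descends
from `θ` by simple roots whose lengths are those of roots of `I` (`exists_isMinusculeOf`).

If `I` is long, only long simple roots are subtracted. They do not affect the coefficients of short
simple roots, by linear independence. If `I` contains a short root, one of greatest height among the
short roots of `I` is dominant, hence not orthogonal to `θ`; adding it lowers the coefficient of a
short simple root, and later steps never raise it.

Uniqueness of `w` follows from the exchange condition. The rootlet is long because it lies in the
isometric orbit of `θ` modulo `δ`. -/

noncomputable section

namespace LongAbelianIdeal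

/-! ### Dominance, height and length of the highest root -/

section HighestRootProperties

variable {ι V N : Type*} [AddCommGroup V] [Module ℝ V] [AddCommGroup N] [Module ℝ N]
  {P : RootPairing ι ℝ V N}

lemma root_reflectionPerm_self (i : ι) : P.root (P.reflectionPerm i i) = -P.root i := by
  simp

lemma reflectionPerm_self_self (i : ι) :
    P.reflectionPerm (P.reflectionPerm i i) (P.reflectionPerm i i) = i :=
  P.root.injective (by rw [root_reflectionPerm_self, root_reflectionPerm_self, neg_neg])

lemma height_neg (b : P.Base) (i : ι) : b.height (P.reflectionPerm i i) = -b.height i :=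
  b.height_reflectionPerm_self i

lemma isPos_neg_iff (b : P.Base) (i : ι) : b.IsPos (P.reflectionPerm i i) ↔ ¬ b.IsPos i :=
  RootPairing.Base.IsPos.neg_iff_not b i

lemma pairingIn_reflectionPerm_self_left [P.IsCrystallographic] (i j : ι) :
    P.pairingIn ℤ (P.reflectionPerm i i) j = -P.pairingIn ℤ i j := by
  simp

lemma pairingIn_reflectionPerm_self_right [P.IsCrystallographic] (i j : ι) :
    P.pairingIn ℤ i (P.reflectionPerm j j) = -P.pairingIn ℤ i j := by
  simp

lemma root_reflectionPerm_eq [P.IsCrystallographic] (i j : ι) :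
    P.root (P.reflectionPerm j i) = P.root i - P.pairingIn ℤ i j • P.root j := by
  rw [P.root_reflectionPerm, P.reflection_apply_root' ℤ]

variable [Finite ι] [P.IsRootSystem] [P.IsCrystallographic] [P.IsReduced] [P.IsIrreducible]

lemma height_lt_height_highestRoot (b : P.Base) {i : ι} (h : i ≠ highestRoot b) :
    b.height i < b.height (highestRoot b) :=
  height_nonneg_of_mem b (highestRoot_isHighest b i) h.symm

lemma height_le_height_highestRoot (b : P.Base) (i : ι) :
    b.height i ≤ b.height (highestRoot b) := by
  rcases eq_or_ne i (highestRoot b) with rfl | h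
  · rfl
  · exact (height_lt_height_highestRoot b h).le

lemma highestRoot_top (b : P.Base) (m : ι)
    (h : P.root m - P.root (highestRoot b) ∈ posCone b) : m = highestRoot b := by
  by_contra hne
  have := height_nonneg_of_mem b h hne
  have := height_le_height_highestRoot b m
  omega

lemma isPos_highestRoot (b : P.Base) : b.IsPos (highestRoot b) :=
  isPos_of_top b (highestRoot_top b)

lemma isMaxRoot_highestRoot (b : P.Base) : IsMaxRoot b (highestRoot b) :=
  isMaxRoot_of_top b (highestRoot_top b)

omit [P.IsRootSystem] [P.IsReduced] [P.IsIrreducible] in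
lemma pairingIn_swap_nonneg {i j : ι} (h : 0 ≤ P.pairingIn ℤ i j) : 0 ≤ P.pairingIn ℤ j i := by
  rcases h.lt_or_eq with h | h
  · exact ((P.zero_lt_pairingIn_iff' ℤ).1 h).le
  · exact (P.pairingIn_eq_zero_iff.1 h.symm).ge

omit [P.IsRootSystem] [P.IsReduced] [P.IsIrreducible] in
/-- A root whose pairings with the simple roots are nonnegative pairs nonnegatively with all
positive roots. -/
lemma pairingIn_nonneg_of_dominant (b : P.Base) {i k : ι}
    (hd : ∀ j ∈ b.support, 0 ≤ P.pairingIn ℤ i j) (hk : b.IsPos k) :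
    0 ≤ P.pairingIn ℤ k i := by
  obtain ⟨f, hf⟩ := exists_sum_of_isPos b hk
  rw [pairingIn_sum b hf]
  exact Finset.sum_nonneg fun j hj =>
    mul_nonneg (by positivity) (pairingIn_swap_nonneg (hd j hj))

lemma pairingIn_highestRoot_nonneg (b : P.Base) {k : ι} (hk : b.IsPos k) :
    0 ≤ P.pairingIn ℤ k (highestRoot b) :=
  pairingIn_nonneg_of_dominant b
    (fun _ hj => pairingIn_nonneg b (isMaxRoot_highestRoot b) (isPos_highestRoot b) hj) hk

/-- The highest root is not orthogonal to any dominant root. -/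
lemma pairingIn_highestRoot_pos_of_dominant (b : P.Base) {i : ι} (hi : b.IsPos i)
    (hd : ∀ j ∈ b.support, 0 ≤ P.pairingIn ℤ i j) :
    0 < P.pairingIn ℤ (highestRoot b) i := by
  obtain ⟨f, hf⟩ := exists_sum_of_isPos b (isPos_highestRoot b)
  rw [pairingIn_sum b hf]
  obtain ⟨j, hj, hji⟩ := hi.exists_mem_support_pos_pairingIn
  refine Finset.sum_pos' (fun m hm =>
    mul_nonneg (by positivity) (pairingIn_swap_nonneg (hd m hm))) ⟨j, hj, ?_⟩
  have := coeff_ne_zero b (isMaxRoot_highestRoot b) (isPos_highestRoot b) hf hj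
  positivity

/-- A positive root other than the highest one stays a root after adding a suitable positive
root. -/
lemma exists_isPos_root_add (b : P.Base) {i : ι} (hi : b.IsPos i) (hne : i ≠ highestRoot b) :
    ∃ j k, b.IsPos j ∧ P.root k = P.root i + P.root j := by
  -- If no simple root can be added, the root is dominant, hence pairs positively with `θ`, and its
  -- difference from `θ` is a root of positive height.
  by_cases hm : IsMaxRoot b i
  · have h1 := pairingIn_highestRoot_pos_of_dominant b hi fun j hj => pairingIn_nonneg b hm hi hj
    obtain ⟨l, hl⟩ := P.root_sub_root_mem_of_pairingIn_pos h1 hne.symm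
    refine ⟨l, highestRoot b, ?_, by rw [hl]; abel⟩
    have := height_lt_height_highestRoot b hne
    rw [RootPairing.Base.isPos_iff, b.height_sub hl]
    omega
  · simp only [IsMaxRoot, not_forall, not_not] at hm
    obtain ⟨j, hj, k, hk⟩ := hm
    exact ⟨j, k, RootPairing.Base.isPos_of_mem_support hj, hk⟩

/-- Roots other than the highest root `θ` pair with `θ` to at most `1`. -/
lemma pairingIn_highestRoot_le_one (b : P.Base) {i : ι}
    (hne : i ≠ highestRoot b) : P.pairingIn ℤ i (highestRoot b) ≤ 1 := by
  by_contra! h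
  -- With `n ≥ 2` the pairing and `β` the root, `-s_θ β = nθ - β` would be higher than `θ`.
  have h1 := root_reflectionPerm_eq (P := P) i (highestRoot b)
  rw [sub_eq_add_neg, ← neg_smul] at h1
  have h2 := b.height_add_zsmul h1
  have h3 := height_le_height_highestRoot b
    (P.reflectionPerm (P.reflectionPerm (highestRoot b) i) (P.reflectionPerm (highestRoot b) i))
  rw [height_neg, h2] at h3
  have h4 := height_lt_height_highestRoot b hne
  have h5 : 0 < b.height (highestRoot b) := isPos_highestRoot b
  simp only [smul_eq_mul] at h3
  nlinarith

/-- The highest root is at least as long as any dominant root. -/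
lemma form_le_form_highestRoot_of_dominant (b : P.Base) (B : P.InvariantForm)
    (hB : ∀ x : V, x ≠ 0 → 0 < B.form x x) {i : ι} (hi : b.IsPos i)
    (hd : ∀ j ∈ b.support, 0 ≤ P.pairingIn ℤ i j) :
    B.form (P.root i) (P.root i) ≤ B.form (P.root (highestRoot b)) (P.root (highestRoot b)) := by
  rcases eq_or_ne i (highestRoot b) with rfl | hne
  · rfl
  have h1 := pairingIn_highestRoot_pos_of_dominant b hi hd
  have h2 := pairingIn_highestRoot_le_one b hne
  have h3 := (P.zero_lt_pairingIn_iff' ℤ).1 h1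
  have h4 := B.pairing_mul_eq_pairing_mul_swap i (highestRoot b)
  rw [← P.algebraMap_pairingIn ℤ, ← P.algebraMap_pairingIn ℤ,
    show P.pairingIn ℤ i (highestRoot b) = 1 by omega] at h4
  have h5 : (1 : ℝ) ≤ (P.pairingIn ℤ (highestRoot b) i : ℝ) := by exact_mod_cast h1
  have h6 := hB _ (P.ne_zero i)
  simp only [algebraMap_int_eq, eq_intCast, Int.cast_one, one_mul] at h4
  nlinarith

omit [P.IsRootSystem] [P.IsReduced] [P.IsIrreducible] [P.IsCrystallographic] [Finite ι] in
lemma form_reflectionPerm (B : P.InvariantForm) (i j : ι) :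
    B.form (P.root (P.reflectionPerm i j)) (P.root (P.reflectionPerm i j)) =
      B.form (P.root j) (P.root j) := by
  rw [P.root_reflectionPerm, B.apply_reflection_reflection]

/-- Among the roots of a given length take one of greatest height. It is positive, since otherwise
its negative would be higher, and dominant, since otherwise a simple reflection would raise it. A
dominant root is no longer than `θ`. -/
lemma isLong_highestRoot (b : P.Base) (B : P.InvariantForm)
    (hB : ∀ x : V, x ≠ 0 → 0 < B.form x x) : IsLong B (highestRoot b) := by
  intro i
  obtain ⟨k, hk, hmax⟩ := Set.exists_max_image
    {k | B.form (P.root k) (P.root k) = B.form (P.root i) (P.root i)}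
    b.height (Set.toFinite _) ⟨i, rfl⟩
  have hpos : b.IsPos k := by
    by_contra h
    have h1 := hmax (P.reflectionPerm k k) (by simpa [form_reflectionPerm] using hk)
    rw [height_neg] at h1
    rw [RootPairing.Base.isPos_iff] at h
    have := b.height_ne_zero k
    omega
  have h := form_le_form_highestRoot_of_dominant b B hB hpos fun j hj => by
    by_contra! hneg
    have h1 := hmax (P.reflectionPerm j k) (by simpa [form_reflectionPerm] using hk)
    have h2 := root_reflectionPerm_eq (P := P) k j
    rw [sub_eq_add_neg, ← neg_smul] at h2
    rw [b.height_add_zsmul h2, RootPairing.Base.height_one_of_mem_support hj] at h1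
    simp only [smul_eq_mul] at h1
    omega
  exact (le_of_eq hk.symm).trans h

end HighestRootProperties

/-! ### Consequences of two root lengths -/

section Lengths

variable {ι V N : Type*} [AddCommGroup V] [Module ℝ V] [AddCommGroup N] [Module ℝ N]
  {P : RootPairing ι ℝ V N}

lemma isLong_or_isShort {B : P.InvariantForm} (h : HasTwoRootLengths B) (i : ι) :
    IsLong B i ∨ IsShort B i := by
  by_contra! hi
  simp only [IsLong, IsShort, not_forall, not_le] at hi
  obtain ⟨⟨j, hj⟩, k, hk⟩ := hi
  obtain ⟨x, y, -, hxy⟩ := Set.ncard_eq_two.1 h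
  have key (l : ι) : B.form (P.root l) (P.root l) = x ∨ B.form (P.root l) (P.root l) = y := by
    have : B.form (P.root l) (P.root l) ∈ range fun i => B.form (P.root i) (P.root i) := ⟨l, rfl⟩
    rw [hxy] at this
    simpa using this
  rcases key i with h1 | h1 <;> rcases key j with h2 | h2 <;> rcases key k with h3 | h3 <;>
    rw [h1, h2] at hj <;> rw [h1, h3] at hk <;> linarith

lemma not_isShort_of_isLong {B : P.InvariantForm} (h : HasTwoRootLengths B) {i : ι}
    (hl : IsLong B i) : ¬ IsShort B i := by
  intro hs
  have : (range fun i => B.form (P.root i) (P.root i)) = {B.form (P.root i) (P.root i)} := by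
    ext x
    simp only [mem_range, mem_singleton_iff]
    constructor
    · rintro ⟨j, rfl⟩
      exact le_antisymm (hl j) (hs j)
    · rintro rfl
      exact ⟨i, rfl⟩
  rw [HasTwoRootLengths, this, Set.ncard_singleton] at h
  omega

/-- Pairing with a root that is at least as long gives `-1`, `0`, `1`, except for proportional
roots. -/
lemma neg_one_le_pairingIn_of_form_le [Finite ι] [P.IsCrystallographic] [P.IsReduced] (B : P.InvariantForm)
    (hB : ∀ x : V, x ≠ 0 → 0 < B.form x x) {i j : ι}
    (hle : B.form (P.root i) (P.root i) ≤ B.form (P.root j) (P.root j))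
    (hne : P.root i ≠ P.root j) (hne' : P.root i ≠ -P.root j) :
    -1 ≤ P.pairingIn ℤ i j ∧ P.pairingIn ℤ i j ≤ 1 := by
  have h := B.pairing_mul_eq_pairing_mul_swap i j
  rw [← P.algebraMap_pairingIn ℤ, ← P.algebraMap_pairingIn ℤ] at h
  have h1 := hB _ (P.ne_zero i)
  have h2 := P.pairingIn_pairingIn_mem_set_of_isCrystal_of_isRed' i j hne hne'
  simp only [mem_insert_iff, Prod.mk.injEq, mem_singleton_iff] at h2
  rcases h2 with h2 | h2 | h2 | h2 | h2 | h2 | h2 | h2 | h2 | h2 | h2 <;>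
    obtain ⟨ha, hb⟩ := h2 <;> rw [ha, hb] at h <;> rw [ha] <;> norm_num at h ⊢ <;> linarith

end Lengths

/-! ### Affine roots and their reflections -/

section AffineRoots

variable {ι V N : Type*} [AddCommGroup V] [Module ℝ V] [AddCommGroup N] [Module ℝ N]
  {P : RootPairing ι ℝ V N}

lemma affRoot_inj {i j : ι} {k l : ℤ} :
    affRoot P i k = affRoot P j l ↔ i = j ∧ k = l := by
  simp [affRoot]

lemma neg_affRoot (i : ι) (k : ℤ) :
    -affRoot P i k = affRoot P (P.reflectionPerm i i) (-k) := by
  simp [affRoot]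

lemma delta_sub_affRoot (i : ι) :
    delta V - affRoot P i 0 = affRoot P (P.reflectionPerm i i) 1 := by
  simp [affRoot, delta]

lemma affRoot_add {i j l : ι} (h : P.root l = P.root i + P.root j) (k m : ℤ) :
    affRoot P l (k + m) = affRoot P i k + affRoot P j m := by
  simp [affRoot, h]

lemma affRoot_mem_affPosRoots {b : P.Base} {i : ι} {k : ℤ} :
    affRoot P i k ∈ affPosRoots b ↔ 1 ≤ k ∨ k = 0 ∧ b.IsPos i := by
  constructor
  · rintro ⟨j, l, h, hp⟩
    obtain ⟨rfl, rfl⟩ := affRoot_inj.1 h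
    exact hp
  · exact fun h => ⟨i, k, rfl, h⟩

lemma neg_affRoot_mem_affPosRoots_iff {b : P.Base} {i : ι} {k : ℤ} :
    -affRoot P i k ∈ affPosRoots b ↔ affRoot P i k ∉ affPosRoots b := by
  rw [neg_affRoot, affRoot_mem_affPosRoots, affRoot_mem_affPosRoots, isPos_neg_iff]
  rcases lt_trichotomy k 0 with h | rfl | h
  · have : ¬ 1 ≤ k := by omega
    have : 1 ≤ -k := by omega
    simp [*, h.ne]
  · simp
  · have : ¬ 1 ≤ -k := by omega
    have : 1 ≤ k := by omega
    simp [*, h.ne']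

lemma neg_notMem_affPosRoots {b : P.Base} {x : AffSpace V} (hx : x ∈ affPosRoots b) :
    -x ∉ affPosRoots b := by
  obtain ⟨i, k, rfl, h⟩ := hx
  rw [neg_affRoot_mem_affPosRoots_iff, not_not]
  exact ⟨i, k, rfl, h⟩

lemma affReflection_affRoot [P.IsCrystallographic] (B : P.InvariantForm) (i j : ι) (k l : ℤ) :
    affReflection B i k (affRoot P j l) =
      affRoot P (P.reflectionPerm i j) (l - P.pairingIn ℤ j i * k) := by
  have h : 2 * affForm B (affRoot P j l) (affRoot P i k) /
      affForm B (affRoot P i k) (affRoot P i k) = (P.pairingIn ℤ j i : ℝ) := by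
    rw [affForm_affRoot_self, div_eq_iff (B.ne_zero i)]
    have := B.two_mul_apply_root_root j i
    rw [← P.algebraMap_pairingIn ℤ] at this
    simpa [affForm_apply, affRoot] using this
  rw [affReflection_apply, h]
  ext
  · simp only [affRoot, root_reflectionPerm_eq, Prod.fst_sub, Prod.smul_fst,
      Int.cast_smul_eq_zsmul]
  · simp [affRoot]
  · simp [affRoot]

lemma affReflection_self (B : P.InvariantForm) (i : ι) (k : ℤ) :
    affReflection B i k (affRoot P i k) = -affRoot P i k := by
  rw [affReflection_apply, mul_div_cancel_right₀ _ (by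
    rw [affForm_affRoot_self]; exact B.ne_zero i), two_smul]
  abel

lemma affReflection_mul_self (B : P.InvariantForm) (i : ι) (k : ℤ) :
    affReflection B i k * affReflection B i k = 1 := by
  ext1 x
  exact Module.involutive_reflection _ x

lemma affReflection_inv (B : P.InvariantForm) (i : ι) (k : ℤ) :
    (affReflection B i k)⁻¹ = affReflection B i k :=
  inv_eq_of_mul_eq_one_left (affReflection_mul_self B i k)

lemma affForm_comm (B : P.InvariantForm) (x y : AffSpace V) : affForm B x y = affForm B y x := by
  have := B.symm.eq x.1 y.1
  simp only [RingHom.id_apply] at this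
  rw [affForm_apply, affForm_apply, this]
  ring

lemma affForm_affReflection (B : P.InvariantForm) (i : ι) (k : ℤ) (x y : AffSpace V) :
    affForm B (affReflection B i k x) (affReflection B i k y) = affForm B x y := by
  have h : affForm B (affRoot P i k) (affRoot P i k) ≠ 0 := by
    rw [affForm_affRoot_self]; exact B.ne_zero i
  simp only [affReflection_apply, map_sub, map_smul, LinearMap.sub_apply, LinearMap.smul_apply,
    smul_eq_mul, affForm_comm B (affRoot P i k) y]
  field_simp
  ring

lemma affForm_delta_affRoot (B : P.InvariantForm) (i : ι) (k : ℤ) :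
    affForm B (delta V) (affRoot P i k) = 0 := by
  simp [affForm_apply, delta, affRoot]

lemma affReflection_delta (B : P.InvariantForm) (i : ι) (k : ℤ) :
    affReflection B i k (delta V) = delta V := by
  simp [affReflection_apply, affForm_delta_affRoot]

/-- Conjugating a reflection by an isometry that maps one affine root to another. -/
lemma mul_affReflection_of_isometry (B : P.InvariantForm) {w : AffSpace V ≃ₗ[ℝ] AffSpace V}
    (hw : ∀ x y, affForm B (w x) (w y) = affForm B x y) {i j : ι} {k l : ℤ}
    (h : w (affRoot P i k) = affRoot P j l) :
    w * affReflection B i k = affReflection B j l * w := by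
  ext1 x
  simp only [LinearEquiv.mul_apply, affReflection_apply, map_sub, map_smul, h]
  rw [← hw x, ← hw (affRoot P i k), h]

end AffineRoots

/-! ### The affine Weyl group and its inversion sets -/

section AffineWeylGroup

variable {ι V N : Type*} [Finite ι] [AddCommGroup V] [Module ℝ V] [AddCommGroup N] [Module ℝ N]
  {P : RootPairing ι ℝ V N} [P.IsRootSystem] [P.IsCrystallographic] [P.IsReduced]
  [P.IsIrreducible]

/-- The pairs `(i, k)` for which `αᵢ + kδ` is one of the simple affine roots `α₀, …, α_p`. -/
def IsAffSimple (b : P.Base) (i : ι) (k : ℤ) : Prop :=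
  (i ∈ b.support ∧ k = 0) ∨ (i = P.reflectionPerm (highestRoot b) (highestRoot b) ∧ k = 1)

lemma IsAffSimple.mem_affPosRoots {b : P.Base} {i : ι} {k : ℤ} (h : IsAffSimple b i k) :
    affRoot P i k ∈ affPosRoots b := by
  rw [affRoot_mem_affPosRoots]
  rcases h with ⟨h, rfl⟩ | ⟨-, rfl⟩
  · exact .inr ⟨rfl, RootPairing.Base.isPos_of_mem_support h⟩
  · exact .inl le_rfl

lemma affReflection_mem_affWeylGroup (b : P.Base) (B : P.InvariantForm) {i : ι} {k : ℤ}
    (h : IsAffSimple b i k) : affReflection B i k ∈ affWeylGroup b B := by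
  apply Subgroup.subset_closure
  rcases h with ⟨h, rfl⟩ | ⟨rfl, rfl⟩
  · exact mem_insert_of_mem _ ⟨i, h, rfl⟩
  · exact mem_insert _ _

lemma affWeylGroup_induction {b : P.Base} {B : P.InvariantForm}
    {p : (AffSpace V ≃ₗ[ℝ] AffSpace V) → Prop} (one : p 1)
    (mul : ∀ i k w, IsAffSimple b i k → p w → p (affReflection B i k * w))
    {w : AffSpace V ≃ₗ[ℝ] AffSpace V} (hw : w ∈ affWeylGroup b B) : p w := by
  have gen : ∀ x ∈ insert (reflectionZero b B) ((fun i => affReflection B i 0) '' b.support),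
      ∃ i k, IsAffSimple b i k ∧ x = affReflection B i k := by
    rintro x (rfl | ⟨i, hi, rfl⟩)
    · exact ⟨_, _, .inr ⟨rfl, rfl⟩, rfl⟩
    · exact ⟨_, _, .inl ⟨hi, rfl⟩, rfl⟩
  refine Subgroup.closure_induction_left (p := fun w _ => p w) one ?_ ?_ hw
  · intro x hx y _ hy
    obtain ⟨i, k, h, rfl⟩ := gen x hx
    exact mul i k y h hy
  · intro x hx y _ hy
    obtain ⟨i, k, h, rfl⟩ := gen x hx
    rw [affReflection_inv]
    exact mul i k y h hy

variable {b : P.Base} {B : P.InvariantForm} {w : AffSpace V ≃ₗ[ℝ] AffSpace V}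

lemma exists_affRoot_of_mem_affWeylGroup (hw : w ∈ affWeylGroup b B) (i : ι) (k : ℤ) :
    ∃ j l, w (affRoot P i k) = affRoot P j l := by
  refine affWeylGroup_induction (p := fun w => ∃ j l, w (affRoot P i k) = affRoot P j l)
    ⟨i, k, rfl⟩ ?_ hw
  rintro j l w - ⟨i', k', h⟩
  exact ⟨_, _, by rw [LinearEquiv.mul_apply, h, affReflection_affRoot]⟩

lemma apply_delta_of_mem_affWeylGroup (hw : w ∈ affWeylGroup b B) : w (delta V) = delta V := by
  refine affWeylGroup_induction (p := fun w => w (delta V) = delta V) rfl ?_ hw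
  intro i k w _ h
  rw [LinearEquiv.mul_apply, h, affReflection_delta]

lemma affForm_of_mem_affWeylGroup (hw : w ∈ affWeylGroup b B) (x y : AffSpace V) :
    affForm B (w x) (w y) = affForm B x y := by
  refine affWeylGroup_induction
    (p := fun w => affForm B (w x) (w y) = affForm B x y) rfl ?_ hw
  intro i k w _ h
  rw [LinearEquiv.mul_apply, LinearEquiv.mul_apply, affForm_affReflection, h]

lemma reflectionPerm_highestRoot_isPos {i : ι} (hi : b.IsPos i)
    (h : P.pairingIn ℤ i (highestRoot b) = 0) :
    b.IsPos (P.reflectionPerm (highestRoot b) i) := by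
  have : P.reflectionPerm (highestRoot b) i = i :=
    P.root.injective (by rw [root_reflectionPerm_eq, h]; simp)
  rwa [this]

/-- A simple reflection permutes the positive affine roots other than its simple root. -/
lemma affReflection_mem_affPosRoots (B : P.InvariantForm) {i : ι} {k : ℤ}
    (hs : IsAffSimple b i k) {x : AffSpace V} (hx : x ∈ affPosRoots b) (hne : x ≠ affRoot P i k) :
    affReflection B i k x ∈ affPosRoots b := by
  obtain ⟨j, l, rfl, hp⟩ := hx
  rw [affReflection_affRoot, affRoot_mem_affPosRoots]
  rw [Ne, affRoot_inj] at hne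
  rcases hs with ⟨h, rfl⟩ | ⟨rfl, rfl⟩
  · rcases hp with hp | ⟨rfl, hp⟩
    · left; simpa using hp
    · right
      exact ⟨by simp, hp.reflectionPerm h fun h => hne ⟨h, rfl⟩⟩
  have hperm : P.reflectionPerm (P.reflectionPerm (highestRoot b) (highestRoot b)) j = P.reflectionPerm (highestRoot b) j := by
    apply P.root.injective
    rw [root_reflectionPerm_eq j, root_reflectionPerm_eq j, pairingIn_reflectionPerm_self_right,
      root_reflectionPerm_self]
    simp
  -- Now `s₀` sends `β + lδ` to `s_θ β + (l + n)δ` with `n = ⟨β, θ^∨⟩`. Apart from `β = -θ` one has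
  -- `n ≥ -1`, so the level drops by at most one.
  rw [hperm, pairingIn_reflectionPerm_self_right, mul_one, sub_neg_eq_add]
  rcases eq_or_ne j (highestRoot b) with rfl | hj0
  · left
    rw [P.pairingIn_same]
    omega
  rcases eq_or_ne j (P.reflectionPerm (highestRoot b) (highestRoot b)) with rfl | hj'
  · have h1 : P.reflectionPerm (highestRoot b) (P.reflectionPerm (highestRoot b) (highestRoot b)) = (highestRoot b) := by simp
    rw [h1, pairingIn_reflectionPerm_self_left, P.pairingIn_same]
    have h_pos := isPos_highestRoot b
    rw [isPos_neg_iff] at hp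
    have : l ≠ 1 := fun h => hne ⟨rfl, h⟩
    have : 2 ≤ l := by
      rcases hp with hp | ⟨-, hp⟩
      · omega
      · exact absurd h_pos hp
    rcases this.lt_or_eq with h | rfl
    · left; omega
    · right; exact ⟨by norm_num, h_pos⟩
  have hm : -1 ≤ P.pairingIn ℤ j (highestRoot b) := by
    have h := pairingIn_highestRoot_le_one b (i := P.reflectionPerm j j) (fun h => hj' (by
      rw [← h, reflectionPerm_self_self]))
    rw [pairingIn_reflectionPerm_self_left] at h
    omega
  rcases hp with hp | ⟨rfl, hp⟩
  · rcases (show 1 ≤ l + P.pairingIn ℤ j (highestRoot b) ∨ P.pairingIn ℤ j (highestRoot b) = -1 ∧ l = 1 by omega) with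
      h | ⟨h, rfl⟩
    · exact .inl h
    -- Here the image is `θ + β` at level `0`, positive because `-β` is lower than `θ`.
    · right
      refine ⟨by omega, ?_⟩
      have h1 : P.root (P.reflectionPerm (highestRoot b) j) = P.root (highestRoot b) - P.root (P.reflectionPerm j j) := by
        rw [root_reflectionPerm_eq, h, root_reflectionPerm_self]
        simp [add_comm]
      have h2 := height_lt_height_highestRoot b (i := P.reflectionPerm j j) (fun h => hj' (by
        rw [← h, reflectionPerm_self_self]))
      rw [RootPairing.Base.isPos_iff, b.height_sub h1]
      omega
  · have h1 := pairingIn_highestRoot_nonneg b hp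
    rcases h1.lt_or_eq with h | h
    · left; omega
    · right
      refine ⟨by omega, reflectionPerm_highestRoot_isPos hp h.symm⟩

/-- The simple affine roots, as a type. -/
abbrev AffSimple (b : P.Base) := {p : ι × ℤ // IsAffSimple b p.1 p.2}

/-- The product of simple reflections along a word. -/
def wordProd (B : P.InvariantForm) (L : List (AffSimple b)) : AffSpace V ≃ₗ[ℝ] AffSpace V :=
  (L.map fun p => affReflection B p.1.1 p.1.2).prod

lemma wordProd_cons (p : AffSimple b) (L : List (AffSimple b)) :
    wordProd B (p :: L) = affReflection B p.1.1 p.1.2 * wordProd B L := by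
  simp [wordProd]

lemma wordProd_mem (L : List (AffSimple b)) : wordProd B L ∈ affWeylGroup b B := by
  induction L with
  | nil => exact one_mem _
  | cons p L ih =>
    rw [wordProd_cons]
    exact mul_mem (affReflection_mem_affWeylGroup b B p.2) ih

lemma exists_wordProd (hw : w ∈ affWeylGroup b B) :
    ∃ L : List (AffSimple b), w = wordProd B L := by
  refine affWeylGroup_induction (p := fun w => ∃ L : List (AffSimple b), w = wordProd B L)
    ⟨[], by simp [wordProd]⟩ ?_ hw
  intro i k w h ⟨L, hL⟩
  refine ⟨⟨(i, k), h⟩ :: L, ?_⟩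
  rw [wordProd_cons, hL]

/-- The exchange condition. -/
lemma exchange (L : List (AffSimple b)) (p : AffSimple b)
    (h : -wordProd B L (affRoot P p.1.1 p.1.2) ∈ affPosRoots b) :
    ∃ L' : List (AffSimple b), L'.length + 1 = L.length ∧
      wordProd B L * affReflection B p.1.1 p.1.2 = wordProd B L' := by
  induction L with
  | nil => exact absurd h (neg_notMem_affPosRoots p.2.mem_affPosRoots)
  | cons q L ih =>
    rw [wordProd_cons] at h ⊢
    obtain ⟨j, l, hjl⟩ := exists_affRoot_of_mem_affWeylGroup (wordProd_mem (B := B) L) p.1.1 p.1.2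
    by_cases hneg : -wordProd B L (affRoot P p.1.1 p.1.2) ∈ affPosRoots b
    · obtain ⟨L', hL', hL''⟩ := ih hneg
      exact ⟨q :: L', by simp [hL'], by rw [mul_assoc, hL'', wordProd_cons]⟩
    · rw [hjl, neg_affRoot_mem_affPosRoots_iff, not_not] at hneg
      rw [LinearEquiv.mul_apply, hjl] at h
      -- The letter `q` is the one that makes the root negative. A simple reflection does this to no
      -- positive root but its own, so the two roots agree; conjugation then cancels `q` against
      -- `p`.
      have heq : affRoot P j l = affRoot P q.1.1 q.1.2 := by
        by_contra hne
        exact neg_notMem_affPosRoots (affReflection_mem_affPosRoots B q.2 hneg hne) h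
      refine ⟨L, rfl, ?_⟩
      rw [mul_assoc, mul_affReflection_of_isometry B
        (affForm_of_mem_affWeylGroup (wordProd_mem L)) (hjl.trans heq), ← mul_assoc,
        affReflection_mul_self, one_mul]

/-- An element of the affine Weyl group that preserves positivity is trivial. -/
lemma eq_one_of_forall_mem_affPosRoots (hw : w ∈ affWeylGroup b B)
    (h : ∀ x ∈ affPosRoots b, w x ∈ affPosRoots b) : w = 1 := by
  obtain ⟨L, rfl⟩ := exists_wordProd hw
  induction hn : L.length using Nat.strong_induction_on generalizing L with
  | _ n ih =>
    rcases L.eq_nil_or_concat with rfl | ⟨L₀, p, rfl⟩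
    · rfl
    have hprod : wordProd B (L₀ ++ [p]) = wordProd B L₀ * affReflection B p.1.1 p.1.2 := by
      simp [wordProd]
    -- The whole word keeps `α_p` positive, so without its last letter it makes `α_p` negative.
    -- Exchange then gives a word for the same element that is shorter by two letters.
    obtain ⟨L', hL', hL''⟩ := exchange (B := B) L₀ p (by
      have := h _ p.2.mem_affPosRoots
      rwa [List.concat_eq_append, hprod, LinearEquiv.mul_apply, affReflection_self, map_neg] at this)
    rw [List.concat_eq_append, hprod, hL''] at h hw ⊢
    refine ih L'.length ?_ L' hw h rfl
    simp at hn
    omega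

lemma mem_affPosRoots_of_notMem_affInversions (hw : w ∈ affWeylGroup b B) {x : AffSpace V}
    (hx : x ∈ affPosRoots b) (h : x ∉ affInversions b w) : w x ∈ affPosRoots b := by
  obtain ⟨i, k, rfl, hp⟩ := id hx
  obtain ⟨j, l, hjl⟩ := exists_affRoot_of_mem_affWeylGroup hw i k
  by_contra hneg
  rw [hjl, ← neg_affRoot_mem_affPosRoots_iff, ← hjl] at hneg
  exact h ⟨hx, hneg⟩

/-- An element of the affine Weyl group is determined by its inversion set. -/
lemma eq_of_affInversions_eq {w' : AffSpace V ≃ₗ[ℝ] AffSpace V} (hw : w ∈ affWeylGroup b B)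
    (hw' : w' ∈ affWeylGroup b B) (h : affInversions b w = affInversions b w') : w = w' := by
  rw [← mul_inv_eq_one]
  refine eq_one_of_forall_mem_affPosRoots (mul_mem hw (inv_mem hw')) ?_
  intro x hx
  obtain ⟨i, k, rfl, -⟩ := id hx
  obtain ⟨j, l, hjl⟩ := exists_affRoot_of_mem_affWeylGroup (inv_mem hw') i k
  have hback : w' (affRoot P j l) = affRoot P i k := by
    rw [← hjl]
    exact LinearEquiv.apply_symm_apply w' _
  rw [LinearEquiv.mul_apply, hjl]
  -- For `y = w'⁻¹ x`: if `y` is positive, neither `w'` nor `w` inverts it; if `y` is negative, `w'`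
  -- inverts `-y`, hence so does `w`. Either way `w y` is positive.
  by_cases hp : affRoot P j l ∈ affPosRoots b
  · refine mem_affPosRoots_of_notMem_affInversions hw hp fun hinv => ?_
    rw [h] at hinv
    exact neg_notMem_affPosRoots hx (hback ▸ hinv.2)
  · have : -affRoot P j l ∈ affInversions b w := by
      rw [h]
      exact ⟨neg_affRoot_mem_affPosRoots_iff.2 hp, by rwa [map_neg, neg_neg, hback]⟩
    have := this.2
    rwa [map_neg, neg_neg] at this

end AffineWeylGroup

/-! ### Abelian ideals: lowest, highest and short members -/

section Ideals

variable {ι V N : Type*} [Finite ι] [AddCommGroup V] [Module ℝ V] [AddCommGroup N] [Module ℝ N]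
  {P : RootPairing ι ℝ V N} {b : P.Base} {I : Set ι}

omit [Finite ι] in
lemma height_lt_of_root_eq_add {i j k : ι} (hj : b.IsPos j) (h : P.root k = P.root i + P.root j) :
    b.height i < b.height k := by
  have := b.height_add h
  have : 0 < b.height j := hj
  omega

omit [Finite ι] in
-- Adding a positive root strictly raises height, so a root of least height is never reached from
-- another member.
lemma IsAbelianIdeal.diff_singleton (hI : IsAbelianIdeal b I) {γ : ι}
    (hmin : ∀ i ∈ I, b.height γ ≤ b.height i) : IsAbelianIdeal b (I \ {γ}) where
  isPos i hi := hI.isPos i hi.1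
  add_notMem i hi j hj := hI.add_notMem i hi.1 j hj.1
  mem_of_add i hi j hj k h := by
    refine ⟨hI.mem_of_add i hi.1 j hj k h, ?_⟩
    rintro rfl
    have := hmin i hi.1
    have := height_lt_of_root_eq_add hj h
    omega

lemma IsAbelianIdeal.highestRoot_mem [P.IsRootSystem] [P.IsCrystallographic] [P.IsReduced]
    [P.IsIrreducible] (hI : IsAbelianIdeal b I) (hne : I.Nonempty) : highestRoot b ∈ I := by
  obtain ⟨i, hi, hmax⟩ := Set.exists_max_image I b.height (Set.toFinite _) hne
  rcases eq_or_ne i (highestRoot b) with rfl | hne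
  · exact hi
  obtain ⟨j, k, hj, hk⟩ := exists_isPos_root_add b (hI.isPos i hi) hne
  have := hmax k (hI.mem_of_add i hi j hj k hk)
  have := height_lt_of_root_eq_add hj hk
  omega

/-- An ideal that contains a short root contains a short root that is not orthogonal to the
highest root. -/
lemma IsAbelianIdeal.exists_isShort_pairingIn_pos [P.IsRootSystem] [P.IsCrystallographic]
    [P.IsReduced] [P.IsIrreducible] (hI : IsAbelianIdeal b I) (B : P.InvariantForm)
    (hB : ∀ x : V, x ≠ 0 → 0 < B.form x x) {i : ι} (hi : i ∈ I) (hs : IsShort B i) :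
    ∃ γ ∈ I, IsShort B γ ∧ 0 < P.pairingIn ℤ (highestRoot b) γ := by
  obtain ⟨γ, ⟨hγ, hγs⟩, hmax⟩ := Set.exists_max_image {γ | γ ∈ I ∧ IsShort B γ} b.height
    (Set.toFinite _) ⟨i, hi, hs⟩
  refine ⟨γ, hγ, hγs, pairingIn_highestRoot_pos_of_dominant b (hI.isPos γ hγ) fun j hj => ?_⟩
  -- A short root that is not proportional to `αⱼ` pairs with it to at least `-1`. A negative
  -- pairing is thus `-1`, and `sⱼ γ = γ + αⱼ` would be a higher short member of the ideal.
  by_contra! hneg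
  have hjpos := RootPairing.Base.isPos_of_mem_support hj
  have h1 := (neg_one_le_pairingIn_of_form_le B hB (hγs j) (fun h => by
    rw [P.root.injective h, P.pairingIn_same] at hneg
    omega) (fun h => by
    have h' : γ = P.reflectionPerm j j := P.root.injective (by rw [h, root_reflectionPerm_self])
    have := hI.isPos γ hγ
    rw [h', isPos_neg_iff] at this
    exact this hjpos)).1
  have h2 := root_reflectionPerm_eq (P := P) γ j
  rw [show P.pairingIn ℤ γ j = -1 by omega, neg_one_smul, sub_neg_eq_add] at h2
  have h3 := hmax (P.reflectionPerm j γ) ⟨hI.mem_of_add γ hγ j hjpos _ h2, fun k => by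
    rw [form_reflectionPerm]; exact hγs k⟩
  have := height_lt_of_root_eq_add hjpos h2
  omega

end Ideals

/-! ### Non-simple positive affine roots are decomposable -/

section Decomposition

variable {ι V N : Type*} [Finite ι] [AddCommGroup V] [Module ℝ V] [AddCommGroup N] [Module ℝ N]
  {P : RootPairing ι ℝ V N} [P.IsRootSystem] [P.IsCrystallographic] [P.IsReduced]
  [P.IsIrreducible] {b : P.Base} {B : P.InvariantForm}

omit [P.IsRootSystem] [P.IsReduced] in
-- By irreducibility some root of the other length is not orthogonal to the given one. Having
-- another length it is not proportional to it, so the sum or the difference is a root. This fails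
-- in type `A₁`, which two lengths exclude.
lemma exists_root_sub_root_mem (hlen : HasTwoRootLengths B) (i : ι) :
    ∃ j l, P.root l = P.root i - P.root j := by
  obtain ⟨j, hj⟩ : ∃ j, B.form (P.root j) (P.root j) ≠ B.form (P.root i) (P.root i) := by
    by_contra! h
    exact not_isShort_of_isLong hlen (i := i) (fun j => (h j).le) (fun j => (h j).ge)
  obtain ⟨k, hk, hik⟩ := P.exists_form_eq_form_and_form_ne_zero B i j
  have hpair : P.pairingIn ℤ i k ≠ 0 := by
    intro h
    refine hik (B.apply_root_root_zero_iff i k |>.2 ?_)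
    rw [← P.algebraMap_pairingIn ℤ, h, map_zero]
  rcases lt_or_gt_of_ne hpair with h | h
  · obtain ⟨l, hl⟩ := P.root_sub_root_mem_of_pairingIn_pos (i := i) (j := P.reflectionPerm k k)
      (by rw [pairingIn_reflectionPerm_self_right]; omega) (by
        rintro rfl
        rw [form_reflectionPerm] at hj
        exact hj hk.symm)
    exact ⟨_, l, hl⟩
  · obtain ⟨l, hl⟩ := P.root_sub_root_mem_of_pairingIn_pos h (by
      rintro rfl
      exact hj hk.symm)
    exact ⟨_, l, hl⟩

/-- A positive affine root that is not simple is the sum of two positive affine roots. -/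
lemma exists_affRoot_eq_add (hlen : HasTwoRootLengths B) {i : ι} {k : ℤ}
    (hp : affRoot P i k ∈ affPosRoots b) (hs : ¬ IsAffSimple b i k) :
    ∃ x ∈ affPosRoots b, ∃ y ∈ affPosRoots b, affRoot P i k = x + y := by
  suffices ∃ j l m n, affRoot P j m ∈ affPosRoots b ∧ affRoot P l n ∈ affPosRoots b ∧
      P.root i = P.root j + P.root l ∧ k = m + n by
    obtain ⟨j, l, m, n, h1, h2, h3, rfl⟩ := this
    exact ⟨_, h1, _, h2, affRoot_add h3 m n⟩
  simp only [affRoot_mem_affPosRoots] at hp ⊢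
  by_cases hk : k = 0
  · subst hk
    have hi : b.IsPos i := by simpa using hp
    obtain ⟨j, hj, hji⟩ := hi.exists_mem_support_pos_pairingIn
    rw [P.zero_lt_pairingIn_iff'] at hji
    obtain ⟨l, hl⟩ := P.root_sub_root_mem_of_pairingIn_pos hji (by
      rintro rfl
      exact hs (.inl ⟨hj, rfl⟩))
    exact ⟨j, l, 0, 0, .inr ⟨rfl, RootPairing.Base.isPos_of_mem_support hj⟩,
      .inr ⟨rfl, hi.sub hj hl⟩, by rw [hl]; abel, rfl⟩
  have hk1 : 1 ≤ k := by
    rcases hp with hp | ⟨hp, -⟩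
    · exact hp
    · exact absurd hp hk
  obtain ⟨j, l, hl⟩ := exists_root_sub_root_mem hlen i
  -- From level `2` on both summands get a positive level, whatever the signs of the finite roots.
  -- At level `1` one summand stays at level `0` and must be a positive root.
  by_cases hk2 : 2 ≤ k
  · exact ⟨j, l, 1, k - 1, .inl le_rfl, .inl (by omega), by rw [hl]; abel, by ring⟩
  obtain rfl : k = 1 := by omega
  by_cases hi : b.IsPos i
  · by_cases hj : b.IsPos j
    · exact ⟨j, l, 0, 1, .inr ⟨rfl, hj⟩, .inl le_rfl, by rw [hl]; abel, rfl⟩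
    · refine ⟨j, l, 1, 0, .inl le_rfl, .inr ⟨rfl, ?_⟩, by rw [hl]; abel, rfl⟩
      rw [RootPairing.Base.isPos_iff] at hi hj ⊢
      rw [b.height_sub hl]
      omega
  -- For negative `β ≠ -θ`, the root `-β` can be raised to a root `κ = -β + ν`, and then `β + δ = ν
  -- + (δ - κ)`.
  · rw [← isPos_neg_iff] at hi
    obtain ⟨ν, κ, hν, hκ⟩ := exists_isPos_root_add b hi (fun h => hs (.inr ⟨by
      rw [← h, reflectionPerm_self_self], rfl⟩))
    refine ⟨ν, P.reflectionPerm κ κ, 0, 1, .inr ⟨rfl, hν⟩, .inl le_rfl, ?_, rfl⟩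
    rw [root_reflectionPerm_self, hκ, root_reflectionPerm_self]
    abel

end Decomposition

/-! ### Adding one root to a minuscule element -/

section Minuscule

variable {ι V N : Type*} [Finite ι] [AddCommGroup V] [Module ℝ V] [AddCommGroup N] [Module ℝ N]
  {P : RootPairing ι ℝ V N} [P.IsRootSystem] [P.IsCrystallographic] [P.IsReduced]
  [P.IsIrreducible] {b : P.Base} {B : P.InvariantForm} {I : Set ι}
  {w : AffSpace V ≃ₗ[ℝ] AffSpace V}

lemma IsMinusculeOf.affRoot_mem_iff (hw : IsMinusculeOf b B w I) {i : ι} {k : ℤ} :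
    affRoot P i k ∈ affInversions b w ↔ P.reflectionPerm i i ∈ I ∧ k = 1 := by
  rw [hw.2]
  simp only [mem_ofPred_eq, delta_sub_affRoot, affRoot_inj]
  constructor
  · rintro ⟨j, hj, rfl, rfl⟩
    exact ⟨by rwa [reflectionPerm_self_self], rfl⟩
  · rintro ⟨h, rfl⟩
    exact ⟨_, h, (reflectionPerm_self_self i).symm, rfl⟩

/-- If `w` is minuscule for `I \ {γ}`, then it does not map both summands of a decomposition
`δ - γ = x + y` to positive affine roots. -/
lemma IsMinusculeOf.false_of_add_eq (hI : IsAbelianIdeal b I) {γ : ι} (hγ : γ ∈ I)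
    (hw : IsMinusculeOf b B w (I \ {γ})) {i j : ι} {k l : ℤ}
    (hroot : P.root i + P.root j = -P.root γ) (hkl : k + l = 1)
    (hi : w (affRoot P i k) ∈ affPosRoots b) (hj : w (affRoot P j l) ∈ affPosRoots b) : False := by
  wlog hle : k ≤ l generalizing i j k l
  · exact this (by rw [add_comm, hroot]) (by omega) hj hi (by omega)
  have hj' : P.root (P.reflectionPerm j j) = P.root γ + P.root i := by
    rw [root_reflectionPerm_self, ← neg_neg (P.root γ), ← hroot]
    abel
  -- As `k ≤ 0`, a positive first summand is a finite root `i`. Then `γ + i` lies in `I \ {γ}`, and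
  -- `w` inverts the second summand. If the first summand is negative, `w` inverts its opposite, so
  -- `i` itself lies in `I`, although `γ + i` is a root.
  by_cases hpos : affRoot P i k ∈ affPosRoots b
  · rw [affRoot_mem_affPosRoots] at hpos
    obtain ⟨rfl, hi_pos⟩ : k = 0 ∧ b.IsPos i := hpos.resolve_left (by omega)
    obtain rfl : l = 1 := by omega
    have hmem := hI.mem_of_add γ hγ i hi_pos _ hj'
    have hne : P.reflectionPerm j j ≠ γ := by
      intro h
      rw [h] at hj'
      exact P.ne_zero i (by simpa using hj')
    exact neg_notMem_affPosRoots hj (hw.affRoot_mem_iff.2 ⟨⟨hmem, hne⟩, rfl⟩).2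
  · have hinv : -affRoot P i k ∈ affInversions b w :=
      ⟨neg_affRoot_mem_affPosRoots_iff.2 hpos, by rwa [map_neg, neg_neg]⟩
    rw [neg_affRoot, hw.affRoot_mem_iff, reflectionPerm_self_self] at hinv
    exact hI.add_notMem γ hγ i hinv.1.1 ⟨_, hj'⟩

/-- Removing a minimal root `γ` from an Abelian ideal: if `w` is minuscule for the smaller ideal,
then `w (δ - γ)` is simple. -/
lemma IsMinusculeOf.exists_isAffSimple (hlen : HasTwoRootLengths B) (hI : IsAbelianIdeal b I)
    {γ : ι} (hγ : γ ∈ I) (hw : IsMinusculeOf b B w (I \ {γ})) :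
    ∃ i k, IsAffSimple b i k ∧ w (affRoot P (P.reflectionPerm γ γ) 1) = affRoot P i k := by
  obtain ⟨i, k, hik⟩ := exists_affRoot_of_mem_affWeylGroup hw.1 (P.reflectionPerm γ γ) 1
  refine ⟨i, k, ?_, hik⟩
  by_contra hs
  have hpos : affRoot P i k ∈ affPosRoots b := by
    rw [← hik]
    refine mem_affPosRoots_of_notMem_affInversions hw.1
      (affRoot_mem_affPosRoots.2 (.inl le_rfl)) ?_
    rw [hw.affRoot_mem_iff, reflectionPerm_self_self]
    simp
  obtain ⟨x, hx, y, hy, hxy⟩ := exists_affRoot_eq_add hlen hpos hs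
  obtain ⟨i₁, k₁, rfl, -⟩ := id hx
  obtain ⟨i₂, k₂, rfl, -⟩ := id hy
  obtain ⟨j₁, l₁, h₁⟩ := exists_affRoot_of_mem_affWeylGroup (inv_mem hw.1) i₁ k₁
  obtain ⟨j₂, l₂, h₂⟩ := exists_affRoot_of_mem_affWeylGroup (inv_mem hw.1) i₂ k₂
  have e₁ : w (affRoot P j₁ l₁) = affRoot P i₁ k₁ := by
    rw [← h₁]; exact LinearEquiv.apply_symm_apply w _
  have e₂ : w (affRoot P j₂ l₂) = affRoot P i₂ k₂ := by
    rw [← h₂]; exact LinearEquiv.apply_symm_apply w _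
  have hsum : affRoot P (P.reflectionPerm γ γ) 1 = affRoot P j₁ l₁ + affRoot P j₂ l₂ := by
    apply w.injective
    rw [map_add, e₁, e₂, ← hxy, hik]
  refine hw.false_of_add_eq hI hγ (i := j₁) (j := j₂) (k := l₁) (l := l₂) ?_ ?_
    (by rwa [e₁]) (by rwa [e₂])
  · have := congrArg Prod.fst hsum
    simpa [affRoot] using this.symm
  · have := congrArg (fun x => x.2.1) hsum
    simp only [affRoot, Prod.snd_add, Prod.fst_add] at this
    exact_mod_cast this.symm

/-- The simple reflection permutes all positive affine roots but its own, so composing with it adds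
exactly the preimage `δ - γ` to the inversion set. -/
lemma IsMinusculeOf.affReflection_mul {γ : ι} (hγ : γ ∈ I) (hw : IsMinusculeOf b B w (I \ {γ}))
    {i : ι} {k : ℤ} (hs : IsAffSimple b i k)
    (hik : w (affRoot P (P.reflectionPerm γ γ) 1) = affRoot P i k) :
    IsMinusculeOf b B (affReflection B i k * w) I := by
  refine ⟨mul_mem (affReflection_mem_affWeylGroup b B hs) hw.1, ?_⟩
  have hset : {x | ∃ i ∈ I, x = delta V - affRoot P i 0} =
      insert (affRoot P (P.reflectionPerm γ γ) 1) (affInversions b w) := by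
    rw [hw.2]
    ext x
    simp only [mem_ofPred_eq, mem_insert_iff, mem_sdiff, mem_singleton_iff]
    constructor
    · rintro ⟨j, hj, rfl⟩
      rcases eq_or_ne j γ with rfl | hne
      · exact .inl (delta_sub_affRoot j)
      · exact .inr ⟨j, ⟨hj, hne⟩, rfl⟩
    · rintro (rfl | ⟨j, hj, rfl⟩)
      · exact ⟨γ, hγ, (delta_sub_affRoot γ).symm⟩
      · exact ⟨j, hj.1, rfl⟩
  have hγpos : affRoot P (P.reflectionPerm γ γ) 1 ∈ affPosRoots b :=
    affRoot_mem_affPosRoots.2 (.inl le_rfl)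
  rw [hset]
  ext x
  constructor
  · rintro ⟨hx, hneg⟩
    by_cases hinv : x ∈ affInversions b w
    · exact .inr hinv
    have hwx := mem_affPosRoots_of_notMem_affInversions hw.1 hx hinv
    left
    by_contra hne
    refine neg_notMem_affPosRoots (affReflection_mem_affPosRoots B hs hwx fun h => hne ?_) hneg
    exact w.injective (h.trans hik.symm)
  · rintro (rfl | ⟨hx, hneg⟩)
    · refine ⟨hγpos, ?_⟩
      rw [LinearEquiv.mul_apply, hik, affReflection_self, neg_neg]
      exact hs.mem_affPosRoots
    · refine ⟨hx, ?_⟩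
      rw [LinearEquiv.mul_apply, ← map_neg]
      refine affReflection_mem_affPosRoots B hs hneg fun h => ?_
      rw [← map_neg, ← hik] at h
      have := w.injective h
      rw [← this] at hγpos
      exact neg_notMem_affPosRoots hx hγpos

lemma isMinusculeOf_one : IsMinusculeOf b B 1 (∅ : Set ι) := by
  refine ⟨one_mem _, ?_⟩
  ext x
  simp only [mem_ofPred_eq, mem_empty_iff_false, false_and, exists_false, iff_false]
  rintro ⟨h1, h2⟩
  exact neg_notMem_affPosRoots h1 h2

end Minuscule

/-! ### Coefficients with respect to the simple roots -/

section Coordinates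

variable {ι V N : Type*} [Finite ι] [AddCommGroup V] [Module ℝ V] [AddCommGroup N] [Module ℝ N]
  {P : RootPairing ι ℝ V N} [P.IsRootSystem] {b : P.Base}

omit [Finite ι] in
lemma repr_nonneg_of_mem_posCone {x : V} (hx : x ∈ posCone b) (j : b.support) :
    0 ≤ b.toWeightBasis.repr x j := by
  induction hx using AddSubmonoid.closure_induction with
  | mem x hx =>
    classical
    obtain ⟨i, hi, rfl⟩ := hx
    have := b.toWeightBasis_repr_root ⟨i, hi⟩
    simp only at this
    rw [this, Finsupp.single_apply]
    split_ifs <;> simp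
  | zero => simp
  | add x y _ _ hx hy =>
    rw [map_add, Finsupp.add_apply]
    exact add_nonneg hx hy

omit [Finite ι] in
lemma repr_eq_zero_of_mem_longSimpleSums {B : P.InvariantForm} (hlen : HasTwoRootLengths B)
    {x : V} (hx : x ∈ longSimpleSums b B) {j : b.support} (hj : IsShort B (j : ι)) :
    b.toWeightBasis.repr x j = 0 := by
  induction hx using AddSubmonoid.closure_induction with
  | mem x hx =>
    classical
    obtain ⟨i, ⟨hi, hl⟩, rfl⟩ := hx
    have := b.toWeightBasis_repr_root ⟨i, hi⟩
    simp only at this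
    rw [this, Finsupp.single_apply, if_neg]
    rintro rfl
    exact not_isShort_of_isLong hlen hl hj
  | zero => simp
  | add x y _ _ hx hy => rw [map_add, Finsupp.add_apply, hx, hy, add_zero]

lemma repr_le_repr_highestRoot [P.IsCrystallographic] [P.IsReduced] [P.IsIrreducible] (i : ι)
    (j : b.support) :
    b.toWeightBasis.repr (P.root i) j ≤ b.toWeightBasis.repr (P.root (highestRoot b)) j := by
  have := repr_nonneg_of_mem_posCone (highestRoot_isHighest b i) j
  rw [map_sub, Finsupp.sub_apply] at this
  linarith

end Coordinates

/-! ### Descent of the rootlet from the highest root -/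

section Rootlets

variable {ι V N : Type*} [Finite ι] [AddCommGroup V] [Module ℝ V] [AddCommGroup N] [Module ℝ N]
  {P : RootPairing ι ℝ V N} [P.IsRootSystem] [P.IsCrystallographic] [P.IsReduced]
  [P.IsIrreducible] {b : P.Base} {B : P.InvariantForm} {I : Set ι}
  {w : AffSpace V ≃ₗ[ℝ] AffSpace V}

lemma apply_affRoot_add (hw : w ∈ affWeylGroup b B) {i j : ι} {k l : ℤ}
    (h : w (affRoot P i k) = affRoot P j l) (m : ℤ) :
    w (affRoot P i (k + m)) = affRoot P j (l + m) := by
  have e (i : ι) (k : ℤ) : affRoot P i (k + m) = affRoot P i k + (m : ℝ) • delta V := by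
    simp [affRoot, delta]
  rw [e, e, map_add, map_smul, h, apply_delta_of_mem_affWeylGroup hw]

lemma form_eq_of_apply_affRoot (hw : w ∈ affWeylGroup b B) {i j i' j' : ι} {k l k' l' : ℤ}
    (h : w (affRoot P i k) = affRoot P j l) (h' : w (affRoot P i' k') = affRoot P j' l') :
    B.form (P.root j) (P.root j') = B.form (P.root i) (P.root i') := by
  have := affForm_of_mem_affWeylGroup hw (affRoot P i k) (affRoot P i' k')
  rw [h, h'] at this
  simpa [affForm_apply, affRoot] using this

lemma pairingIn_eq_of_apply_affRoot (hw : w ∈ affWeylGroup b B) {i j i' j' : ι} {k l k' l' : ℤ}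
    (h : w (affRoot P i k) = affRoot P j l) (h' : w (affRoot P i' k') = affRoot P j' l') :
    P.pairingIn ℤ j j' = P.pairingIn ℤ i i' := by
  have h1 := B.two_mul_apply_root_root i i'
  rw [← form_eq_of_apply_affRoot hw h h', ← form_eq_of_apply_affRoot hw h' h',
    B.two_mul_apply_root_root j j'] at h1
  have h2 := mul_right_cancel₀ (B.ne_zero j') h1
  rw [← P.algebraMap_pairingIn ℤ, ← P.algebraMap_pairingIn ℤ] at h2
  exact_mod_cast h2

lemma alphaZero_add_delta_iff {τ : ι} :
    w (alphaZero b) + delta V = affRoot P τ 0 ↔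
      w (affRoot P (P.reflectionPerm (highestRoot b) (highestRoot b)) 1) = affRoot P τ (-1) := by
  have e : affRoot P τ 0 = affRoot P τ (-1) + delta V := by simp [affRoot, delta]
  rw [e, add_left_inj, alphaZero]

variable (b B) in
/-- The relation between an ideal `I` and its rootlet `τ` that is preserved when a root is added
to `I`. -/
structure IsRootletLike (I : Set ι) (τ : ι) : Prop where
  isPos : b.IsPos τ
  sub_mem : IsLongIdeal B I → P.root (highestRoot b) - P.root τ ∈ longSimpleSums b B
  exists_repr_lt : ∀ γ ∈ I, IsShort B γ → 0 < P.pairingIn ℤ (highestRoot b) γ →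
    ∃ j : b.support, IsShort B (j : ι) ∧
      b.toWeightBasis.repr (P.root τ) j < b.toWeightBasis.repr (P.root (highestRoot b)) j

lemma isRootletLike_singleton (hB : ∀ x : V, x ≠ 0 → 0 < B.form x x)
    (hlen : HasTwoRootLengths B) : IsRootletLike b B {highestRoot b} (highestRoot b) where
  isPos := isPos_highestRoot b
  sub_mem _ := by rw [sub_self]; exact zero_mem _
  exists_repr_lt := by
    rintro _ rfl hs
    exact absurd hs (not_isShort_of_isLong hlen (isLong_highestRoot b B hB))

/-- The step for a finite simple reflection. -/
lemma IsRootletLike.reflectionPerm {γ : ι} (hγI : γ ∈ I) (hγ : b.IsPos γ) {τ i : ι}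
    (h : IsRootletLike b B (I \ {γ}) τ) (hi : i ∈ b.support) (hτi : τ ≠ i)
    (hpair : P.pairingIn ℤ τ i = P.pairingIn ℤ (highestRoot b) γ)
    (hform : B.form (P.root i) (P.root i) = B.form (P.root γ) (P.root γ)) :
    IsRootletLike b B I (P.reflectionPerm i τ) := by
  obtain ⟨m, hm⟩ := Int.eq_ofNat_of_zero_le
    (pairingIn_swap_nonneg (pairingIn_highestRoot_nonneg b hγ))
  have hroot := root_reflectionPerm_eq (P := P) τ i
  rw [hpair, hm, natCast_zsmul] at hroot
  refine ⟨h.isPos.reflectionPerm hi hτi, fun hl => ?_, fun γ' hγ' hs hp => ?_⟩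
  · have h1 := h.sub_mem fun j hj => hl j hj.1
    have h2 : P.root i ∈ longSimpleSums b B := AddSubmonoid.subset_closure
      ⟨i, ⟨hi, fun j => by rw [hform]; exact hl γ hγI j⟩, rfl⟩
    have h3 : P.root (highestRoot b) - P.root (P.reflectionPerm i τ) =
        (P.root (highestRoot b) - P.root τ) + m • P.root i := by
      rw [hroot]; abel
    rw [h3]
    exact add_mem h1 (nsmul_mem h2 m)
  · have hrepr (j : b.support) : b.toWeightBasis.repr (P.root (P.reflectionPerm i τ)) j =
        b.toWeightBasis.repr (P.root τ) j - m * b.toWeightBasis.repr (P.root i) j := by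
      rw [hroot, map_sub, map_nsmul]
      simp
    -- For the added root, the coefficient of `αᵢ` drops by `m > 0` from a value not above that of
    -- `θ`. For an earlier root, the strict inequality survives because no coefficient increases.
    by_cases hγγ : γ' = γ
    · subst hγγ
      refine ⟨⟨i, hi⟩, fun j => by rw [hform]; exact hs j, ?_⟩
      have h1 := b.toWeightBasis_repr_root ⟨i, hi⟩
      simp only at h1
      have h2 := repr_le_repr_highestRoot τ ⟨i, hi⟩
      have h3 : (0 : ℝ) < m := by
        rw [hm] at hp
        exact_mod_cast hp
      rw [hrepr, h1, Finsupp.single_eq_same]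
      linarith
    · obtain ⟨j, hj, hlt⟩ := h.exists_repr_lt γ' ⟨hγ', hγγ⟩ hs hp
      refine ⟨j, hj, lt_of_le_of_lt ?_ hlt⟩
      rw [hrepr]
      have h1 := repr_nonneg_of_mem_posCone
        (AddSubmonoid.subset_closure ⟨i, hi, rfl⟩ : P.root i ∈ posCone b) j
      have h2 : (0 : ℝ) ≤ m := Nat.cast_nonneg m
      have := mul_nonneg h2 h1
      linarith

/-- The step for the affine simple reflection. -/
lemma IsRootletLike.of_orthogonal {γ : ι} {τ : ι} (h : IsRootletLike b B (I \ {γ}) τ)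
    (hpair : P.pairingIn ℤ (highestRoot b) γ = 0) :
    IsRootletLike b B I τ where
  isPos := h.isPos
  sub_mem hl := h.sub_mem fun j hj => hl j hj.1
  exists_repr_lt γ' hγ' hs hp := by
    refine h.exists_repr_lt γ' ⟨hγ', ?_⟩ hs hp
    rintro rfl
    omega

/-- Every nonempty Abelian ideal has a minuscule element, whose rootlet is controlled by the
lengths of the roots in the ideal. -/
theorem exists_isMinusculeOf (hB : ∀ x : V, x ≠ 0 → 0 < B.form x x)
    (hlen : HasTwoRootLengths B) (hI : IsAbelianIdeal b I) (hne : I.Nonempty) :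
    ∃ w τ, IsMinusculeOf b B w I ∧ w (alphaZero b) + delta V = affRoot P τ 0 ∧
      IsRootletLike b B I τ := by
  simp only [alphaZero_add_delta_iff]
  induction hn : I.ncard using Nat.strong_induction_on generalizing I with
  | _ n ih =>
  obtain ⟨γ, hγ, hmin⟩ := Set.exists_min_image I b.height (Set.toFinite _) hne
  -- The induction starts at `{θ}`: for the empty ideal `w = 1`, and `w(α₀) + δ = 2δ - θ` is not a
  -- root at level `0`.
  rcases (I \ {γ}).eq_empty_or_nonempty with hemp | hne'
  · obtain rfl : I = {γ} := by
      ext x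
      constructor
      · intro hx
        by_contra h
        exact (hemp ▸ (⟨hx, h⟩ : x ∈ I \ {γ}) : x ∈ (∅ : Set ι))
      · rintro rfl
        exact hγ
    obtain rfl : highestRoot b = γ := hI.highestRoot_mem hne
    have hw : IsMinusculeOf b B 1 ({highestRoot b} \ {highestRoot b}) := by
      rw [sdiff_self]
      exact isMinusculeOf_one
    refine ⟨_, highestRoot b, hw.affReflection_mul hγ (.inr ⟨rfl, rfl⟩) rfl, ?_,
      isRootletLike_singleton hB hlen⟩
    rw [mul_one, affReflection_self, neg_affRoot, reflectionPerm_self_self]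
  have hcard : (I \ {γ}).ncard < n := by
    rw [← hn]
    exact Set.ncard_sdiff_singleton_lt_of_mem hγ (Set.toFinite _)
  obtain ⟨w, τ, hw, hτ, hl⟩ := ih _ hcard (hI.diff_singleton hmin) hne' rfl
  obtain ⟨i, k, hs, hik⟩ := hw.exists_isAffSimple hlen hI hγ
  have hpair : P.pairingIn ℤ τ i = P.pairingIn ℤ (highestRoot b) γ := by
    rw [pairingIn_eq_of_apply_affRoot hw.1 hτ hik, pairingIn_reflectionPerm_self_left,
      pairingIn_reflectionPerm_self_right, neg_neg]
  have hform : B.form (P.root i) (P.root i) = B.form (P.root γ) (P.root γ) := by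
    rw [form_eq_of_apply_affRoot hw.1 hik hik, form_reflectionPerm]
  have hγpos := hI.isPos γ hγ
  have key : (affReflection B i k * w)
      (affRoot P (P.reflectionPerm (highestRoot b) (highestRoot b)) 1) =
      affRoot P (P.reflectionPerm i τ) (-1 - P.pairingIn ℤ τ i * k) := by
    rw [LinearEquiv.mul_apply, hτ, affReflection_affRoot]
  refine ⟨_, P.reflectionPerm i τ, hw.affReflection_mul hγ hs hik, ?_⟩
  rw [key]
  rcases hs with ⟨hi, rfl⟩ | ⟨rfl, rfl⟩
  · refine ⟨by simp, hl.reflectionPerm hγ hγpos hi ?_ hpair hform⟩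
    -- If `τ = αᵢ`, then `w(2δ - θ) = αᵢ = w(δ - γ)`, and the `δ`-coefficients differ.
    rintro rfl
    have h1 := apply_affRoot_add hw.1 hτ 1
    have h2 := w.injective (h1.trans hik.symm)
    have := (affRoot_inj.1 h2).2
    omega
  · have h1 := pairingIn_swap_nonneg (pairingIn_highestRoot_nonneg b hγpos)
    have h2 := pairingIn_highestRoot_nonneg b hl.isPos
    have h3 := hpair
    rw [pairingIn_reflectionPerm_self_right] at h3
    -- The pairing `⟨θ, γ^∨⟩` is nonnegative and equals `-⟨τ, θ^∨⟩`, which is nonpositive.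
    have h0 : P.pairingIn ℤ (highestRoot b) γ = 0 := by omega
    have hfix : P.reflectionPerm (P.reflectionPerm (highestRoot b) (highestRoot b)) τ = τ := by
      apply P.root.injective
      rw [root_reflectionPerm_eq, hpair, h0, zero_smul, sub_zero]
    rw [hfix, hpair, h0]
    exact ⟨by simp, hl.of_orthogonal h0⟩

end Rootlets

end LongAbelianIdeal

end

/-! ### The proposition -/

open LongAbelianIdeal
theorem mainTheorem5 {ι V N : Type*} [Finite ι] [AddCommGroup V] [Module ℝ V]
    [AddCommGroup N] [Module ℝ N] (P : RootPairing ι ℝ V N) [P.IsRootSystem]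
    [P.IsCrystallographic] [P.IsReduced] [P.IsIrreducible] (b : P.Base)
    (B : P.InvariantForm) (hB : ∀ x : V, x ≠ 0 → 0 < B.form x x)
    (hlen : HasTwoRootLengths B)
    (I : Set ι) (hI : IsAbelianIdeal b I) (hne : I.Nonempty) :
    (∃! w, IsMinusculeOf b B w I) ∧
    ∀ w, IsMinusculeOf b B w I →
      ∃ τ : ι, w (alphaZero b) + delta V = affRoot P τ 0 ∧
        b.IsPos τ ∧ IsLong B τ ∧
        (IsLongIdeal B I ↔ P.root (highestRoot b) - P.root τ ∈ longSimpleSums b B) ∧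
        (IsLongIdeal B I ↔ ∀ j : b.support, IsShort B (j : ι) →
          b.toWeightBasis.repr (P.root (highestRoot b)) j =
            b.toWeightBasis.repr (P.root τ) j) := by
  obtain ⟨w, τ, hw, hτ, hl⟩ := exists_isMinusculeOf (b := b) hB hlen hI hne
  have huniq : ∀ w', IsMinusculeOf b B w' I → w' = w := fun w' hw' =>
    eq_of_affInversions_eq hw'.1 hw.1 (hw'.2.trans hw.2.symm)
  refine ⟨⟨w, hw, huniq⟩, fun w' hw' => ?_⟩
  obtain rfl := huniq w' hw'
  have hlong : IsLong B τ := fun j => by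
    have h := alphaZero_add_delta_iff.1 hτ
    rw [form_eq_of_apply_affRoot hw.1 h h, form_reflectionPerm]
    exact isLong_highestRoot b B hB j
  have h_coeff : P.root (highestRoot b) - P.root τ ∈ longSimpleSums b B →
      ∀ j : b.support, IsShort B (j : ι) →
        b.toWeightBasis.repr (P.root (highestRoot b)) j = b.toWeightBasis.repr (P.root τ) j := by
    intro h j hj
    have := repr_eq_zero_of_mem_longSimpleSums hlen h hj
    rwa [map_sub, Finsupp.sub_apply, sub_eq_zero] at this
  have h_long : (∀ j : b.support, IsShort B (j : ι) →
      b.toWeightBasis.repr (P.root (highestRoot b)) j = b.toWeightBasis.repr (P.root τ) j) →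
      IsLongIdeal B I := by
    intro h γ hγ
    by_contra hγl
    -- The given short root may be orthogonal to `θ` and leave no trace in the rootlet; it is
    -- replaced by one that is not.
    obtain ⟨γ', hγ', hs, hp⟩ := hI.exists_isShort_pairingIn_pos B hB hγ
      ((isLong_or_isShort hlen γ).resolve_left hγl)
    obtain ⟨j, hj, hlt⟩ := hl.exists_repr_lt γ' hγ' hs hp
    exact hlt.ne' (h j hj)
  exact ⟨τ, hτ, hl.isPos, hlong, ⟨hl.sub_mem, h_long ∘ h_coeff⟩,
    ⟨h_coeff ∘ hl.sub_mem, h_long⟩⟩
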